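/- Let $H$ be a separable complex Hilbert space with a fixed orthonormal (Hilbert) basis $\{e_k\}$. For $v=\sum_k v^k e_k$ and $w=\sum_k w^k e_k$ in $H$ write $v\circ w=\sum_k v^kw^k e_k$ and $\overline{v}=\sum_k \overline{v^k}\,e_k$. A compact Hermitian operator $C$ on $H$ is called minimal if $\|C\|\le\|C+D\|$ (operator norm) for every compact Hermitian operator $D$ that is diagonal in the fixed basis, i.e. $\langle De_i,e_j\rangle=0$ for all $i\ne j$. For a Hermitian operator $C$ let $\lambda_{\max}(C)$ and $\lambda_{\min}(C)$ be the largest and the smallest element of its spectrum, and let $E_+$ and $E_-$ be the spectral projections of $C$ at $\lambda_{\max}(C)$ and $\lambda_{\min}(C)$, i.e. the orthogonal projections onto $\ker(C-\lambda_{\max}(C)I)$ and $\ker(C-\lambda_{\min}(C)I)$; $R(E_\pm)$ denotes their ranges. Corollary. Let $C\neq 0$ be a compact Hermitian operator on $H$ with $\lambda_{\max}(C)+\lambda_{\min}(C)=0$. Then the following are equivalent: 1. $C$ is minimal. 2. There are finite orthonormal sets $\{v_i\}_{i=1}^{r}\subset R(E_+)$ and $\{v_j\}_{j=r+1}^{r+s}\subset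 R(E_-)$ such that $$\mathrm{co}\big(\{v_i\circ\overline{v_i}\}_{i=1}^{r}\big)\cap \mathrm{co}\big(\{v_j\circ\overline{v_j}\}_{j=r+1}^{r+s}\big)\neq\emptyset,$$ where $\mathrm{co}$ denotes the convex hull. -/

import Mathlib

open scoped ComplexConjugate

noncomputable section

namespace MinimalCompact

variable {ι H : Type*} [NormedAddCommGroup H] [InnerProductSpace ℂ H]

/-- The Hermitian compact operators on `H`. -/
def compactHermitian [CompleteSpace H] : Set (H →L[ℂ] H) :=
  {T | IsSelfAdjoint T ∧ IsCompactOperator T}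

/-- The real diagonal compact operators with respect to the basis `e`, that is, the Hermitian
compact operators `T` such that `⟨T e_i, e_j⟩ = 0` for all `i ≠ j`. -/
def diagonalCompactHermitian [CompleteSpace H] (e : HilbertBasis ι ℂ H) : Set (H →L[ℂ] H) :=
  {T | T ∈ compactHermitian ∧ ∀ i j, i ≠ j → inner ℂ (T (e i)) (e j) = 0}

/-- `C` is minimal: `‖C‖ ≤ ‖C + D‖` for all real diagonal compact operators `D`. -/
def IsMinimal [CompleteSpace H] (e : HilbertBasis ι ℂ H) (C : H →L[ℂ] H) : Prop :=
  ∀ D ∈ diagonalCompactHermitian e, ‖C‖ ≤ ‖C + D‖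

/-- The largest point of the spectrum (which is real, nonempty and compact if `C` is a Hermitian
operator on a nontrivial Hilbert space). -/
def lambdaMax (C : H →L[ℂ] H) : ℝ := sSup (spectrum ℝ C)

/-- The smallest point of the spectrum (which is real, nonempty and compact if `C` is a Hermitian
operator on a nontrivial Hilbert space). -/
def lambdaMin (C : H →L[ℂ] H) : ℝ := sInf (spectrum ℝ C)

/-- The spectral projection of the Hermitian operator `C` at the real number `t`: the orthogonal
projection onto `ker (C - t)`. -/
def spectralProjection [CompleteSpace H] (C : H →L[ℂ] H) (t : ℝ) : H →L[ℂ] H :=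
  (C - (t : ℂ) • ContinuousLinearMap.id ℂ H).ker.starProjection

/-- `E_+`, the spectral projection at the largest eigenvalue. -/
def EPlus [CompleteSpace H] (C : H →L[ℂ] H) : H →L[ℂ] H := spectralProjection C (lambdaMax C)

/-- `E_-`, the spectral projection at the smallest eigenvalue. -/
def EMinus [CompleteSpace H] (C : H →L[ℂ] H) : H →L[ℂ] H := spectralProjection C (lambdaMin C)

/-- The pointwise product of two square summable families is square summable. -/
theorem memℓp_two_mul (f g : lp (fun _ : ι => ℂ) 2) :
    Memℓp (fun i => f i * g i) 2 := by
  have hf := lp.memℓp f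
  refine memℓp_gen ?_
  have hs := (lp.memℓp g).summable (by norm_num)
  refine Summable.of_nonneg_of_le (fun i => by positivity) (fun i => ?_)
    (hs.mul_left (‖f‖ ^ (2 : ENNReal).toReal))
  have h1 : ‖f i‖ ≤ ‖f‖ := lp.norm_apply_le_norm (by norm_num) f i
  rw [norm_mul, Real.mul_rpow (norm_nonneg _) (norm_nonneg _)]
  gcongr

/-- `v ∘ w`, the vector whose coordinates in the basis `e` are the products of those of `v`
and `w`. -/
def coordMul (e : HilbertBasis ι ℂ H) (v w : H) : H :=
  e.repr.symm ⟨fun i => e.repr v i * e.repr w i, memℓp_two_mul (e.repr v) (e.repr w)⟩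

/-- The vector whose coordinates in the basis `e` are the conjugates of those of `v`. -/
def coordConj (e : HilbertBasis ι ℂ H) (v : H) : H :=
  e.repr.symm (star (e.repr v))

/-- The coordinates of `v ∘ w`. -/
theorem repr_coordMul (e : HilbertBasis ι ℂ H) (v w : H) (i : ι) :
    e.repr (coordMul e v w) i = e.repr v i * e.repr w i := by
  simp [coordMul]

/-- The coordinates of the conjugate vector. -/
theorem repr_coordConj (e : HilbertBasis ι ℂ H) (v : H) (i : ι) :
    e.repr (coordConj e v) i = conj (e.repr v i) := by
  simp [coordConj]

end MinimalCompact

end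

namespace MinimalCompact

open Filter Topology

/-! ### Spectral facts, norm perturbation and Gram operators -/

section Operators

variable {H : Type*} [NormedAddCommGroup H] [InnerProductSpace ℂ H]

/-! Balance puts the extreme spectral values at `±‖C‖`, and compactness makes the eigenspaces `E`,
`F` there finite-dimensional. Everything turns on whether `0` lies in the compact convex set
`coordSqDiff e E F`.

If it does not, Hahn–Banach gives a real diagonal operator that is negative on `E` and positive on
`F` (`exists_separating_diagonal`); a multiple of it lowers the norm of `C`
(`exists_norm_add_smul_lt`), so `C` is not minimal. If it does, the two sums of `x ∘ x̄` agree, and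
diagonalizing their Gram operators (`exists_orthonormal_diagonalization`) rewrites them as convex
combinations over orthonormal sets.

Conversely, let `p` be a common point of the hulls. For diagonal `D`, the form `⟪v, D v⟫` depends
only on `v ∘ v̄`, so Rayleigh quotients on both eigenspaces bound both `∑ Dₖₖ pₖ` and its negative
by `‖C + D‖ - ‖C‖`, which is therefore nonnegative. -/

theorem lambdaMax_eq_norm_and_lambdaMin_eq_neg_norm [CompleteSpace H] {C : H →L[ℂ] H}
    (hC : IsSelfAdjoint C) (hC0 : C ≠ 0) (hbal : lambdaMax C + lambdaMin C = 0) :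
    lambdaMax C = ‖C‖ ∧ lambdaMin C = -‖C‖ := by
  have : Nontrivial H := by
    by_contra h
    rw [not_nontrivial_iff_subsingleton] at h
    exact hC0 (ContinuousLinearMap.ext fun x => Subsingleton.elim _ _)
  have hle : ∀ x ∈ spectrum ℝ C, |x| ≤ ‖C‖ := fun x hx => by
    simpa using spectrum.norm_le_norm_of_mem hx
  have hub : ∀ x ∈ spectrum ℝ C, x ≤ ‖C‖ := fun x hx => (abs_le.1 (hle x hx)).2
  have hlb : ∀ x ∈ spectrum ℝ C, -‖C‖ ≤ x := fun x hx => (abs_le.1 (hle x hx)).1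
  unfold lambdaMax lambdaMin at *
  rcases CStarAlgebra.norm_or_neg_norm_mem_spectrum (a := C) hC with h | h
  · have : sSup (spectrum ℝ C) = ‖C‖ := IsGreatest.csSup_eq ⟨h, hub⟩
    exact ⟨this, by linarith⟩
  · have : sInf (spectrum ℝ C) = -‖C‖ := IsLeast.csInf_eq ⟨h, hlb⟩
    exact ⟨by linarith, this⟩

theorem mem_range_spectralProjection [CompleteSpace H] {C : H →L[ℂ] H} {t : ℝ} {x : H} :
    x ∈ Set.range (spectralProjection C t) ↔
      x ∈ (C - (t : ℂ) • ContinuousLinearMap.id ℂ H).ker := by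
  unfold spectralProjection
  constructor
  · rintro ⟨y, rfl⟩
    exact Submodule.starProjection_apply_mem _ _
  · intro h
    exact ⟨x, Submodule.starProjection_eq_self_iff.2 h⟩

theorem mem_ker_sub_smul_id {C : H →L[ℂ] H} {t : ℝ} {x : H} :
    x ∈ (C - (t : ℂ) • ContinuousLinearMap.id ℂ H).ker ↔ C x = (t : ℂ) • x := by
  simp [sub_eq_zero]

theorem finiteDimensional_ker_sub_smul_id [CompleteSpace H] {C : H →L[ℂ] H}
    (hC : IsCompactOperator C) {t : ℝ} (ht : t ≠ 0) :
    FiniteDimensional ℂ (C - (t : ℂ) • ContinuousLinearMap.id ℂ H).ker := by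
  have h := ContinuousLinearMap.finite_dimensional_eigenspace hC (t : ℂ) (by exact_mod_cast ht)
  have : (C - (t : ℂ) • ContinuousLinearMap.id ℂ H).ker
      = Module.End.eigenspace C.toLinearMap (t : ℂ) := by
    ext x
    simp [sub_eq_zero]
  rw [this]
  exact h

/-- A compact self-adjoint operator has an eigenvector at `‖T‖` or at `-‖T‖`. -/
theorem exists_eigenvector_norm [CompleteSpace H] {T : H →L[ℂ] H} (hT : IsSelfAdjoint T)
    (hTc : IsCompactOperator T) (hT0 : T ≠ 0) :
    ∃ x : H, ‖x‖ = 1 ∧ (T x = (‖T‖ : ℂ) • x ∨ (-T) x = (‖T‖ : ℂ) • x) := by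
  have : Nontrivial H := by
    by_contra h
    rw [not_nontrivial_iff_subsingleton] at h
    exact hT0 (ContinuousLinearMap.ext fun x => Subsingleton.elim _ _)
  have key : ∀ t : ℝ, t ≠ 0 → t ∈ spectrum ℝ T → ∃ x : H, ‖x‖ = 1 ∧ T x = (t : ℂ) • x := by
    intro t ht h
    have h' : (t : ℂ) ∈ spectrum ℂ T := by simpa using spectrum.algebraMap_mem ℂ h
    rw [← hTc.hasEigenvalue_iff_mem_spectrum (by exact_mod_cast ht)] at h'
    obtain ⟨y, hy⟩ := h'.exists_hasEigenvector
    have hy0 : ‖y‖ ≠ 0 := norm_ne_zero_iff.2 hy.2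
    refine ⟨((‖y‖⁻¹ : ℝ) : ℂ) • y, ?_, ?_⟩
    · rw [norm_smul]; simp [hy0]
    · have := hy.apply_eq_smul
      simp only [ContinuousLinearMap.coe_coe] at this
      rw [map_smul, this, smul_comm]
  have hn : ‖T‖ ≠ 0 := norm_ne_zero_iff.2 hT0
  rcases CStarAlgebra.norm_or_neg_norm_mem_spectrum (a := T) hT with h | h
  · obtain ⟨x, hx, h⟩ := key _ hn h
    exact ⟨x, hx, Or.inl h⟩
  · obtain ⟨x, hx, h⟩ := key _ (neg_ne_zero.2 hn) h
    exact ⟨x, hx, Or.inr (by simp [h])⟩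

theorem re_inner_apply_le (T : H →L[ℂ] H) {x : H} (hx : ‖x‖ = 1) :
    (inner ℂ x (T x)).re ≤ ‖T‖ := by
  calc (inner ℂ x (T x)).re ≤ ‖inner ℂ x (T x)‖ := Complex.re_le_norm _
    _ ≤ ‖x‖ * ‖T x‖ := norm_inner_le_norm _ _
    _ ≤ ‖T‖ := by simpa [hx] using T.le_opNorm x

/-- If `‖C‖ ≤ ‖C + tₙ D‖` along `tₙ ↓ 0` and the norms are attained at top eigenvectors, then
`D` is nonnegative at some top eigenvector of `C`. -/
theorem exists_top_eigenvector_nonneg {C D : H →L[ℂ] H} (hC : IsCompactOperator C) (hC0 : C ≠ 0)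
    {t : ℕ → ℝ} (ht0 : ∀ n, 0 < t n) (ht : Tendsto t atTop (𝓝 0))
    {x : ℕ → H} (hx : ∀ n, ‖x n‖ = 1) (hle : ∀ n, ‖C‖ ≤ ‖C + (t n : ℂ) • D‖)
    (hTx : ∀ n, (C + (t n : ℂ) • D) (x n) = (‖C + (t n : ℂ) • D‖ : ℂ) • x n) :
    ∃ y : H, ‖y‖ = 1 ∧ C y = (‖C‖ : ℂ) • y ∧ 0 ≤ (inner ℂ y (D y)).re := by
  have hC0' : ‖C‖ ≠ 0 := norm_ne_zero_iff.2 hC0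
  obtain ⟨K, hK, hKC⟩ := hC.image_closedBall_subset_compact 1
  obtain ⟨z, -, φ, hφ, hz⟩ := hK.tendsto_subseq (x := fun n => C (x n))
    (fun n => hKC ⟨x n, by simp [hx n], rfl⟩)
  have htφ : Tendsto (fun n => (t (φ n) : ℂ)) atTop (𝓝 0) := by
    have := (Complex.continuous_ofReal.tendsto 0).comp (ht.comp hφ.tendsto_atTop)
    simpa [Function.comp_def] using this
  have hT : Tendsto (fun n => C + (t (φ n) : ℂ) • D) atTop (𝓝 C) := by
    simpa using tendsto_const_nhds.add (htφ.smul_const D)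
  have hN : Tendsto (fun n => (‖C + (t (φ n) : ℂ) • D‖ : ℂ)) atTop (𝓝 (‖C‖ : ℂ)) :=
    (Complex.continuous_ofReal.tendsto _).comp hT.norm
  have hDx : Tendsto (fun n => (t (φ n) : ℂ) • D (x (φ n))) atTop (𝓝 0) := by
    rw [tendsto_zero_iff_norm_tendsto_zero]
    refine squeeze_zero (fun _ => norm_nonneg _) (g := fun n => ‖(t (φ n) : ℂ)‖ * ‖D‖)
      (fun n => ?_) (by simpa using htφ.norm.mul_const ‖D‖)
    rw [norm_smul]
    gcongr
    simpa [hx] using D.le_opNorm (x (φ n))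
  -- The eigenvalue equation recovers `x (φ n)` from `C (x (φ n))`, so compactness of `C` yields
  -- norm convergence of the eigenvectors themselves.
  have hlim : Tendsto (fun n => (‖C + (t (φ n) : ℂ) • D‖ : ℂ)⁻¹ •
      (C (x (φ n)) + (t (φ n) : ℂ) • D (x (φ n)))) atTop (𝓝 ((‖C‖ : ℂ)⁻¹ • z)) := by
    have := (hN.inv₀ (by exact_mod_cast hC0')).smul (hz.add hDx)
    simpa using this
  have hxlim : Tendsto (fun n => x (φ n)) atTop (𝓝 ((‖C‖ : ℂ)⁻¹ • z)) := by
    refine hlim.congr fun n => ?_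
    have h1 := hTx (φ n)
    have h2 : (‖C + (t (φ n) : ℂ) • D‖ : ℂ) ≠ 0 := by
      have := (norm_pos_iff.2 hC0).trans_le (hle (φ n))
      exact_mod_cast this.ne'
    simp only [add_apply, smul_apply] at h1
    rw [h1, smul_smul, inv_mul_cancel₀ h2, one_smul]
  set y := (‖C‖ : ℂ)⁻¹ • z with hy
  have hCy : C y = z := tendsto_nhds_unique ((C.continuous.tendsto y).comp hxlim) hz
  refine ⟨y, ?_, ?_, ?_⟩
  · refine tendsto_nhds_unique hxlim.norm ?_
    simp [hx]
  · rw [hCy, hy, smul_smul, mul_inv_cancel₀ (by exact_mod_cast hC0'), one_smul]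
  · have hcont : Continuous fun v : H => (inner ℂ v (D v)).re := by fun_prop
    refine ge_of_tendsto' ((hcont.tendsto y).comp hxlim) fun n => ?_
    have h1 : (inner ℂ (x (φ n)) ((C + (t (φ n) : ℂ) • D) (x (φ n)))).re
        = ‖C + (t (φ n) : ℂ) • D‖ := by
      rw [hTx, inner_smul_right, inner_self_eq_norm_sq_to_K, hx]
      simp
    have h2 := re_inner_apply_le C (hx (φ n))
    have h3 := hle (φ n)
    simp only [add_apply, smul_apply, inner_add_right,
      inner_smul_right, Complex.add_re, Complex.re_ofReal_mul] at h1
    -- With `T = C + tD`: `⟪x, Cx⟫ ≤ ‖C‖ ≤ ‖T‖ = ⟪x, Cx⟫ + t⟪x, Dx⟫` in real parts.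
    have h4 : 0 ≤ t (φ n) * (inner ℂ (x (φ n)) (D (x (φ n)))).re := by linarith
    exact nonneg_of_mul_nonneg_right h4 (ht0 _)

/-- First-order perturbation: if `D` is negative on the eigenspace of `C` at `‖C‖` and positive on
that at `-‖C‖`, then some `C + t D` has smaller norm than `C`. -/
theorem exists_norm_add_smul_lt [CompleteSpace H] {C D : H →L[ℂ] H} (hC : IsSelfAdjoint C)
    (hCc : IsCompactOperator C) (hC0 : C ≠ 0) (hD : IsSelfAdjoint D) (hDc : IsCompactOperator D)
    (hneg : ∀ y : H, ‖y‖ = 1 → C y = (‖C‖ : ℂ) • y → (inner ℂ y (D y)).re < 0)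
    (hpos : ∀ y : H, ‖y‖ = 1 → C y = ((-‖C‖ : ℝ) : ℂ) • y → 0 < (inner ℂ y (D y)).re) :
    ∃ t : ℝ, ‖C + (t : ℂ) • D‖ < ‖C‖ := by
  by_contra! hle
  let t : ℕ → ℝ := fun n => 1 / ((n : ℝ) + 1)
  have ht0 : ∀ n, 0 < t n := fun n => by positivity
  have ht : Tendsto t atTop (𝓝 0) := tendsto_one_div_add_atTop_nhds_zero_nat
  have hex : ∀ n, ∃ x : H, ‖x‖ = 1 ∧
      ((C + (t n : ℂ) • D) x = (‖C + (t n : ℂ) • D‖ : ℂ) • x ∨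
        (-(C + (t n : ℂ) • D)) x = (‖C + (t n : ℂ) • D‖ : ℂ) • x) := fun n => by
    refine exists_eigenvector_norm (hC.add (IsSelfAdjoint.smul ?_ hD)) (hCc.add (hDc.smul _)) ?_
    · simp [isSelfAdjoint_iff]
    · have := (norm_pos_iff.2 hC0).trans_le (hle (t n))
      exact norm_pos_iff.1 this
  choose x hx hTx using hex
  have hfreq : (∃ᶠ n in atTop, (C + (t n : ℂ) • D) (x n) = (‖C + (t n : ℂ) • D‖ : ℂ) • x n) ∨
      ∃ᶠ n in atTop, (-(C + (t n : ℂ) • D)) (x n) = (‖C + (t n : ℂ) • D‖ : ℂ) • x n :=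
    frequently_or_distrib.1 (Eventually.of_forall hTx).frequently
  rcases hfreq with h | h
  · obtain ⟨φ, hφ, h⟩ := extraction_of_frequently_atTop h
    obtain ⟨y, hy, hCy, hDy⟩ := exists_top_eigenvector_nonneg (D := D) hCc hC0
      (fun n => ht0 (φ n)) (ht.comp hφ.tendsto_atTop) (fun n => hx (φ n))
      (fun n => hle (t (φ n))) h
    exact absurd (hneg y hy hCy) hDy.not_gt
  · obtain ⟨φ, hφ, h⟩ := extraction_of_frequently_atTop h
    have hrw : ∀ n, -C + (t (φ n) : ℂ) • -D = -(C + (t (φ n) : ℂ) • D) := fun n => by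
      rw [smul_neg, neg_add]
    -- The bottom of `C` is the top of `-C`, perturbed by `-D`.
    obtain ⟨y, hy, hCy, hDy⟩ := exists_top_eigenvector_nonneg (C := -C) (D := -D) hCc.neg
      (neg_ne_zero.2 hC0)
      (fun n => ht0 (φ n)) (ht.comp hφ.tendsto_atTop) (fun n => hx (φ n))
      (fun n => by simpa only [hrw, norm_neg] using hle (t (φ n)))
      (fun n => by simpa only [hrw, norm_neg] using h n)
    have h1 : C y = ((-‖C‖ : ℝ) : ℂ) • y := by
      have : -(C y) = (‖C‖ : ℂ) • y := by simpa using hCy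
      rw [← neg_neg (C y), this]
      simp
    have h2 := hpos y hy h1
    simp at hDy
    linarith

/-- The Gram form of a finite family in a finite-dimensional subspace is diagonal in some
orthonormal basis of the subspace. -/
theorem exists_orthonormal_diagonalization (E : Submodule ℂ H) [FiniteDimensional ℂ E]
    {κ : Type*} [Fintype κ] (x : κ → E) :
    ∃ (u : Fin (Module.finrank ℂ E) → E) (a : Fin (Module.finrank ℂ E) → ℝ),
      Orthonormal ℂ u ∧ (∀ j, 0 ≤ a j) ∧ (∑ i, ‖x i‖ ^ 2 = ∑ j, a j) ∧
      ∀ y : H, ∑ i, ‖inner ℂ y (x i : H)‖ ^ 2 = ∑ j, a j * ‖inner ℂ y (u j : H)‖ ^ 2 := by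
  -- `T = ∑ |xᵢ⟩⟨xᵢ|` is positive with trace `∑ ‖xᵢ‖²`; its eigenbasis and eigenvalues are the
  -- required `u` and `a`.
  let T : E →ₗ[ℂ] E := ∑ i, ((innerSL ℂ (x i)).smulRight (x i) : E →L[ℂ] E).toLinearMap
  have hT : ∀ y, T y = ∑ i, inner ℂ (x i) y • x i := fun y => by simp [T]
  have hTsym : T.IsSymmetric := fun y z => by
    simp only [hT, sum_inner, inner_sum, inner_smul_left, inner_smul_right, inner_conj_symm]
    exact Finset.sum_congr rfl fun i _ => mul_comm _ _
  have hTq : ∀ y, inner ℂ y (T y) = ((∑ i, ‖inner ℂ y (x i)‖ ^ 2 : ℝ) : ℂ) := fun y => by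
    simp only [hT, inner_sum, inner_smul_right, Complex.ofReal_sum]
    refine Finset.sum_congr rfl fun i _ => ?_
    rw [← inner_conj_symm, Complex.conj_mul']
    simp
  let u := hTsym.eigenvectorBasis rfl
  let a := hTsym.eigenvalues rfl
  have hu : ∀ j, T (u j) = (a j : ℂ) • u j := fun j => hTsym.apply_eigenvectorBasis rfl j
  have ha : ∀ j, a j = ∑ i, ‖inner ℂ (u j) (x i)‖ ^ 2 := fun j => by
    have h := hTq (u j)
    rw [hu, inner_smul_right, inner_self_eq_norm_sq_to_K, u.orthonormal.1 j] at h
    simp only [Complex.coe_algebraMap, Complex.ofReal_one, one_pow, mul_one] at h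
    exact_mod_cast h
  refine ⟨u, a, u.orthonormal, fun j => ?_, ?_, fun y => ?_⟩
  · rw [ha]; positivity
  · simp only [ha]
    rw [Finset.sum_comm]
    exact Finset.sum_congr rfl fun i _ => (u.sum_sq_norm_inner_right (x i)).symm
  -- Both sides see only the projection of `y` onto `E`.
  · have hP : ∀ z : E, inner ℂ y (z : H) = inner ℂ (E.orthogonalProjectionOnto y) z := fun z => by
      simp
    simp only [hP]
    set p := E.orthogonalProjectionOnto y
    have h := hTq p
    have h2 : inner ℂ p (T p) = ((∑ j, a j * ‖inner ℂ p (u j)‖ ^ 2 : ℝ) : ℂ) := by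
      rw [← u.sum_inner_mul_inner p (T p), Complex.ofReal_sum]
      refine Finset.sum_congr rfl fun j _ => ?_
      rw [← hTsym, hu, inner_smul_left, ← inner_conj_symm (u j) p]
      simp only [Complex.conj_ofReal, Complex.ofReal_mul, Complex.ofReal_pow]
      rw [← Complex.mul_conj']
      ring
    rw [h2] at h
    exact_mod_cast h.symm

end Operators

/-! ### Coordinatewise products and diagonal operators -/

section Coordinates

variable {ι H : Type*} [NormedAddCommGroup H] [InnerProductSpace ℂ H]

theorem norm_coordMul_le (e : HilbertBasis ι ℂ H) (v w : H) :
    ‖coordMul e v w‖ ≤ ‖v‖ * ‖w‖ := by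
  rw [← e.repr.norm_map (coordMul e v w)]
  refine lp.norm_le_of_forall_sum_le (by norm_num) (by positivity) fun s => ?_
  have hw := lp.sum_rpow_le_norm_rpow (p := 2) (by norm_num) (e.repr w) s
  rw [e.repr.norm_map] at hw
  rw [Real.mul_rpow (norm_nonneg _) (norm_nonneg _)]
  refine le_trans ?_ (mul_le_mul_of_nonneg_left hw (by positivity))
  rw [Finset.mul_sum]
  refine Finset.sum_le_sum fun i _ => ?_
  rw [repr_coordMul, norm_mul, Real.mul_rpow (norm_nonneg _) (norm_nonneg _)]
  gcongr
  rw [← e.repr.norm_map v]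
  exact lp.norm_apply_le_norm (by norm_num) _ i

theorem ext_repr (e : HilbertBasis ι ℂ H) {v w : H} (h : ∀ i, e.repr v i = e.repr w i) :
    v = w :=
  e.repr.injective (lp.ext (funext h))

theorem repr_basis [DecidableEq ι] (e : HilbertBasis ι ℂ H) (i j : ι) :
    e.repr (e i) j = if j = i then 1 else 0 := by
  rw [e.repr_apply_apply, orthonormal_iff_ite.1 e.orthonormal]

/-- The coordinatewise product as a bounded bilinear map; `coordMulL e d` is the diagonal operator
with diagonal `d`. -/
noncomputable def coordMulL (e : HilbertBasis ι ℂ H) : H →L[ℂ] H →L[ℂ] H :=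
  LinearMap.mkContinuous₂
    (LinearMap.mk₂ ℂ (coordMul e)
      (fun v v' w => ext_repr e fun i => by simp [repr_coordMul, add_mul])
      (fun c v w => ext_repr e fun i => by simp [repr_coordMul, mul_assoc])
      (fun v w w' => ext_repr e fun i => by simp [repr_coordMul, mul_add])
      (fun c v w => ext_repr e fun i => by simp [repr_coordMul, mul_left_comm]))
    1 (fun v w => by simpa using norm_coordMul_le e v w)

@[simp]
theorem coordMulL_apply (e : HilbertBasis ι ℂ H) (v w : H) :
    coordMulL e v w = coordMul e v w := rfl

theorem continuous_coordConj (e : HilbertBasis ι ℂ H) : Continuous (coordConj e) :=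
  e.repr.symm.continuous.comp (continuous_star.comp e.repr.continuous)

theorem inner_eq_tsum_repr (e : HilbertBasis ι ℂ H) (v w : H) :
    inner ℂ v w = ∑' i, conj (e.repr v i) * e.repr w i := by
  rw [← e.repr.inner_map_map, lp.inner_eq_tsum]
  simp [mul_comm]

/-- The basis expansion of `d` is carried by the bounded map `coordMulL e` to a norm-convergent sum
of rank-one operators. -/
theorem isCompactOperator_coordMulL [CompleteSpace H] (e : HilbertBasis ι ℂ H) (d : H) :
    IsCompactOperator (coordMulL e d) := by
  classical
  have hone : ∀ i, coordMulL e (e i) ∈ compactOperator (RingHom.id ℂ) H H := fun i => by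
    have : coordMulL e (e i) = (innerSL ℂ (e i)).smulRight (e i) := by
      refine ContinuousLinearMap.ext fun y => ext_repr e fun j => ?_
      rw [coordMulL_apply, repr_coordMul, ContinuousLinearMap.smulRight_apply, map_smul,
        lp.coeFn_smul, Pi.smul_apply, repr_basis, innerSL_apply_apply]
      split_ifs with h
      · simp [h, e.repr_apply_apply]
      · simp
    rw [this]
    have h : IsCompactOperator (ContinuousLinearMap.toSpanSingleton ℂ (e i)) :=
      isCompactOperator_of_locallyCompactSpace_rng _
    exact h.comp_clm (innerSL ℂ (e i))
  have hs := (e.hasSum_repr d).mapL (coordMulL e)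
  refine isCompactOperator_of_tendsto hs (Eventually.of_forall fun s => ?_)
  refine (compactOperator (RingHom.id ℂ) H H).sum_mem fun i _ => ?_
  rw [map_smul]
  exact Submodule.smul_mem _ _ (hone i)

theorem isSelfAdjoint_coordMulL [CompleteSpace H] (e : HilbertBasis ι ℂ H) {d : H}
    (hd : ∀ i, conj (e.repr d i) = e.repr d i) : IsSelfAdjoint (coordMulL e d) := by
  rw [ContinuousLinearMap.isSelfAdjoint_iff_isSymmetric]
  intro x y
  simp only [ContinuousLinearMap.coe_coe, coordMulL_apply, inner_eq_tsum_repr e, repr_coordMul,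
    map_mul, hd]
  exact tsum_congr fun i => by ring

theorem coordMulL_mem_diagonalCompactHermitian [CompleteSpace H] (e : HilbertBasis ι ℂ H) {d : H}
    (hd : ∀ i, conj (e.repr d i) = e.repr d i) :
    coordMulL e d ∈ diagonalCompactHermitian e := by
  classical
  refine ⟨⟨isSelfAdjoint_coordMulL e hd, isCompactOperator_coordMulL e d⟩, fun i j hij => ?_⟩
  rw [← inner_conj_symm, ← e.repr_apply_apply, coordMulL_apply, repr_coordMul, repr_basis]
  simp [hij.symm]

/-- The vector `v ∘ v̄`, whose coordinates are the squared moduli of those of `v`. -/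
noncomputable def coordSq (e : HilbertBasis ι ℂ H) (v : H) : H := coordMul e v (coordConj e v)

theorem repr_coordSq (e : HilbertBasis ι ℂ H) (v : H) (i : ι) :
    e.repr (coordSq e v) i = ((‖inner ℂ (e i) v‖ ^ 2 : ℝ) : ℂ) := by
  rw [coordSq, repr_coordMul, repr_coordConj, Complex.mul_conj', e.repr_apply_apply]
  simp

theorem continuous_coordSq (e : HilbertBasis ι ℂ H) : Continuous (coordSq e) := by
  have : coordSq e = fun v => coordMulL e v (coordConj e v) := rfl
  rw [this]
  exact (coordMulL e).continuous.clm_apply (continuous_coordConj e)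

theorem repr_real_smul (e : HilbertBasis ι ℂ H) (r : ℝ) (v : H) (i : ι) :
    e.repr (r • v) i = (r : ℂ) * e.repr v i := by
  rw [← Complex.coe_smul, map_smul, lp.coeFn_smul, Pi.smul_apply, smul_eq_mul]

theorem coordSq_ofReal_smul (e : HilbertBasis ι ℂ H) (r : ℝ) (v : H) :
    coordSq e ((r : ℂ) • v) = (r ^ 2) • coordSq e v := by
  refine ext_repr e fun i => ?_
  rw [repr_coordSq, repr_real_smul, repr_coordSq, inner_smul_right, norm_mul, mul_pow]
  simp

theorem repr_sum (e : HilbertBasis ι ℂ H) {κ : Type*} (s : Finset κ) (f : κ → H) (i : ι) :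
    e.repr (∑ k ∈ s, f k) i = ∑ k ∈ s, e.repr (f k) i := by
  rw [map_sum, lp.coeFn_sum, Finset.sum_apply]

theorem hasSum_sq_norm_inner (e : HilbertBasis ι ℂ H) (v : H) :
    HasSum (fun i => ‖inner ℂ (e i) v‖ ^ 2) (‖v‖ ^ 2) := by
  have h := Complex.hasSum_re (e.hasSum_inner_mul_inner v v)
  have h2 : ∀ i, (inner ℂ v (e i) * inner ℂ (e i) v).re = ‖inner ℂ (e i) v‖ ^ 2 := fun i => by
    rw [← inner_conj_symm, Complex.conj_mul', ← Complex.ofReal_pow, Complex.ofReal_re]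
  simp only [h2] at h
  rw [inner_self_eq_norm_sq_to_K] at h
  simpa [← Complex.ofReal_pow] using h

/-- For a real vector `d`, the quadratic form of the diagonal operator `d` at `v` is the pairing
of `d` with `v ∘ v̄`. -/
theorem inner_coordMulL_self (e : HilbertBasis ι ℂ H) {d : H}
    (hd : ∀ i, conj (e.repr d i) = e.repr d i) (v : H) :
    inner ℂ v (coordMulL e d v) = inner ℂ d (coordSq e v) := by
  rw [inner_eq_tsum_repr e, inner_eq_tsum_repr e]
  refine tsum_congr fun i => ?_
  rw [coordMulL_apply, repr_coordMul, hd, coordSq, repr_coordMul, repr_coordConj]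
  ring

/-- Since `v ∘ v̄` has real coordinates, `g` and its conjugate pair with it to the same real part;
take `d = g + ḡ`. -/
theorem exists_real_vector_re_inner (e : HilbertBasis ι ℂ H) (g : H) :
    ∃ d : H, (∀ i, conj (e.repr d i) = e.repr d i) ∧
      ∀ v, (inner ℂ d (coordSq e v)).re = 2 * (inner ℂ g (coordSq e v)).re := by
  refine ⟨g + coordConj e g, fun i => ?_, fun v => ?_⟩
  · simp [repr_coordConj, add_comm]
  · have : inner ℂ (coordConj e g) (coordSq e v) = conj (inner ℂ g (coordSq e v)) := by
      rw [inner_eq_tsum_repr e, inner_eq_tsum_repr e, Complex.conj_tsum]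
      refine tsum_congr fun i => ?_
      simp [repr_coordSq, repr_coordConj]
    rw [inner_add_left, this, Complex.add_re, Complex.conj_re]
    ring

/-- The diagonal of `D` need not be square summable, so the form is written as a sum and not as an
inner product with a vector. -/
theorem hasSum_diagonal_re_inner (e : HilbertBasis ι ℂ H) {D : H →L[ℂ] H}
    (hD : ∀ i j, i ≠ j → inner ℂ (D (e i)) (e j) = 0) (v : H) :
    HasSum (fun i => (inner ℂ (e i) (D (e i))).re * (e.repr (coordSq e v) i).re)
      (inner ℂ v (D v)).re := by
  classical
  have hDe : ∀ i, D (e i) = inner ℂ (e i) (D (e i)) • e i := fun i => by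
    refine ext_repr e fun j => ?_
    rw [map_smul, lp.coeFn_smul, Pi.smul_apply, repr_basis]
    split_ifs with h
    · simp [h, e.repr_apply_apply]
    · rw [e.repr_apply_apply, ← inner_conj_symm, hD i j (Ne.symm h)]
      simp
  have h1 := ((e.hasSum_repr v).mapL D).mapL (innerSL ℂ v)
  refine (Complex.hasSum_re h1).congr_fun fun i => ?_
  have h2 : inner ℂ v (D (e i)) = inner ℂ (e i) (D (e i)) * inner ℂ v (e i) := by
    rw [← inner_smul_right, ← hDe]
  rw [repr_coordSq, Complex.ofReal_re, innerSL_apply_apply, map_smul, inner_smul_right, h2,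
    e.repr_apply_apply, ← inner_conj_symm v (e i), mul_left_comm, Complex.mul_conj',
    ← Complex.ofReal_pow, Complex.re_mul_ofReal]

end Coordinates

/-! ### Convexity, compactness and separation for the vectors `v ∘ v̄` -/

section Moments

variable {ι H : Type*} [NormedAddCommGroup H] [InnerProductSpace ℂ H]

theorem sum_coordSq_eq_of_gram_eq (e : HilbertBasis ι ℂ H) {κ κ' : Type*} [Fintype κ] [Fintype κ']
    (x : κ → H) (u : κ' → H) (a : κ' → ℝ)
    (h : ∀ y : H, ∑ i, ‖inner ℂ y (x i)‖ ^ 2 = ∑ j, a j * ‖inner ℂ y (u j)‖ ^ 2) :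
    ∑ i, coordSq e (x i) = ∑ j, a j • coordSq e (u j) := by
  refine ext_repr e fun k => ?_
  simp only [repr_sum, repr_real_smul, repr_coordSq]
  exact_mod_cast h (e k)

/-- A sum of vectors `x ∘ x̄` over a family in `E` is such a sum over a family of `dim E` vectors
of `E` with the same sum of squared norms. -/
theorem exists_sum_coordSq_eq (e : HilbertBasis ι ℂ H) (E : Submodule ℂ H)
    [FiniteDimensional ℂ E] {κ : Type*} [Fintype κ] (x : κ → E) :
    ∃ X : Fin (Module.finrank ℂ E) → E, ∑ i, ‖X i‖ ^ 2 = ∑ i, ‖x i‖ ^ 2 ∧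
      ∑ i, coordSq e (X i : H) = ∑ i, coordSq e (x i : H) := by
  obtain ⟨u, a, hu, ha, hsum, h⟩ := exists_orthonormal_diagonalization E x
  refine ⟨fun j => ((√(a j) : ℝ) : ℂ) • u j, ?_, ?_⟩
  · rw [hsum]
    refine Finset.sum_congr rfl fun j _ => ?_
    rw [norm_smul, hu.1 j, mul_one, Complex.norm_real, Real.norm_eq_abs, sq_abs,
      Real.sq_sqrt (ha j)]
  · rw [sum_coordSq_eq_of_gram_eq e (fun i => (x i : H)) (fun j => (u j : H)) a h]
    refine Finset.sum_congr rfl fun j _ => ?_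
    rw [Submodule.coe_smul, coordSq_ofReal_smul, Real.sq_sqrt (ha j)]

/-- The set of differences `∑ X_i ∘ X̄_i - ∑ Y_j ∘ Ȳ_j` with `X_i ∈ E`, `Y_j ∈ F` and total squared
norm one. -/
noncomputable def coordSqDiff (e : HilbertBasis ι ℂ H) (E F : Submodule ℂ H) : Set H :=
  (fun p : (Fin (Module.finrank ℂ E) → E) × (Fin (Module.finrank ℂ F) → F) =>
      ∑ i, coordSq e (p.1 i : H) - ∑ j, coordSq e (p.2 j : H)) ''
    {p | ∑ i, ‖p.1 i‖ ^ 2 + ∑ j, ‖p.2 j‖ ^ 2 = 1}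

theorem mem_coordSqDiff_of_families (e : HilbertBasis ι ℂ H) (E F : Submodule ℂ H)
    [FiniteDimensional ℂ E] [FiniteDimensional ℂ F] {κ κ' : Type*} [Fintype κ] [Fintype κ']
    (x : κ → E) (y : κ' → F) (h : ∑ i, ‖x i‖ ^ 2 + ∑ j, ‖y j‖ ^ 2 = 1) :
    ∑ i, coordSq e (x i : H) - ∑ j, coordSq e (y j : H) ∈ coordSqDiff e E F := by
  obtain ⟨X, hX, hX'⟩ := exists_sum_coordSq_eq e E x
  obtain ⟨Y, hY, hY'⟩ := exists_sum_coordSq_eq e F y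
  exact ⟨(X, Y), by simp only [Set.mem_ofPred_eq, hX, hY, h], by simp only [hX', hY']⟩

theorem isCompact_coordSqDiff (e : HilbertBasis ι ℂ H) (E F : Submodule ℂ H)
    [FiniteDimensional ℂ E] [FiniteDimensional ℂ F] : IsCompact (coordSqDiff e E F) := by
  have : ProperSpace E := FiniteDimensional.proper ℂ E
  have : ProperSpace F := FiniteDimensional.proper ℂ F
  refine IsCompact.image ?_ ?_
  · refine Metric.isCompact_of_isClosed_isBounded
      (isClosed_eq (by fun_prop) continuous_const) ?_
    refine (Metric.isBounded_closedBall (x := 0) (r := 1)).subset fun p hp => ?_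
    have hp' : ∑ i, ‖p.1 i‖ ^ 2 + ∑ j, ‖p.2 j‖ ^ 2 = 1 := hp
    have h1 : 0 ≤ ∑ i, ‖p.1 i‖ ^ 2 := by positivity
    have h2 : 0 ≤ ∑ j, ‖p.2 j‖ ^ 2 := by positivity
    rw [mem_closedBall_zero_iff, Prod.norm_def, max_le_iff, pi_norm_le_iff_of_nonneg zero_le_one,
      pi_norm_le_iff_of_nonneg zero_le_one]
    refine ⟨fun i => ?_, fun j => ?_⟩
    · have := Finset.single_le_sum (f := fun i => ‖p.1 i‖ ^ 2) (fun i _ => by positivity)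
        (Finset.mem_univ i)
      exact (sq_le_one_iff₀ (norm_nonneg _)).1 (by linarith)
    · have := Finset.single_le_sum (f := fun j => ‖p.2 j‖ ^ 2) (fun i _ => by positivity)
        (Finset.mem_univ j)
      exact (sq_le_one_iff₀ (norm_nonneg _)).1 (by linarith)
  · have := continuous_coordSq e
    fun_prop

/-- Scaling two families by `√a` and `√b` and concatenating them realizes the convex combination;
Gram diagonalization then brings the number of vectors back to the dimension. -/
theorem convex_coordSqDiff (e : HilbertBasis ι ℂ H) (E F : Submodule ℂ H)
    [FiniteDimensional ℂ E] [FiniteDimensional ℂ F] : Convex ℝ (coordSqDiff e E F) := by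
  rintro _ ⟨⟨X, Y⟩, h, rfl⟩ _ ⟨⟨X', Y'⟩, h', rfl⟩ a b ha hb hab
  simp only [Set.mem_ofPred_eq] at h h'
  have hn : ∀ (G : Submodule ℂ H) (c : ℝ), 0 ≤ c → ∀ z : G,
      ‖((√c : ℝ) : ℂ) • z‖ ^ 2 = c * ‖z‖ ^ 2 := fun G c hc z => by
    rw [norm_smul, mul_pow, Complex.norm_real, Real.norm_eq_abs, sq_abs, Real.sq_sqrt hc]
  have hsq : ∀ (G : Submodule ℂ H) (c : ℝ), 0 ≤ c → ∀ z : G,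
      coordSq e ((((√c : ℝ) : ℂ) • z : G) : H) = c • coordSq e (z : H) := fun G c hc z => by
    rw [Submodule.coe_smul, coordSq_ofReal_smul, Real.sq_sqrt hc]
  have key := mem_coordSqDiff_of_families e E F
    (Sum.elim (fun i => ((√a : ℝ) : ℂ) • X i) (fun i => ((√b : ℝ) : ℂ) • X' i))
    (Sum.elim (fun i => ((√a : ℝ) : ℂ) • Y i) (fun i => ((√b : ℝ) : ℂ) • Y' i)) (by
      simp only [Fintype.sum_sum_type, Sum.elim_inl, Sum.elim_inr, hn _ a ha, hn _ b hb,
        ← Finset.mul_sum]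
      linear_combination a * h + b * h' + hab)
  simp only [Fintype.sum_sum_type, Sum.elim_inl, Sum.elim_inr, hsq _ a ha, hsq _ b hb,
    ← Finset.smul_sum] at key
  convert key using 1
  simp only [smul_sub]
  abel

/-- By Parseval, the vector `∑ xᵢ ∘ x̄ᵢ` determines the total squared norm of the family. -/
theorem hasSum_repr_sum_coordSq (e : HilbertBasis ι ℂ H) {κ : Type*} [Fintype κ] (x : κ → H) :
    HasSum (fun k => (e.repr (∑ i, coordSq e (x i)) k).re) (∑ i, ‖x i‖ ^ 2) := by
  have := hasSum_sum (s := Finset.univ) fun i _ => hasSum_sq_norm_inner e (x i)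
  refine this.congr_fun fun k => ?_
  rw [repr_sum, Complex.re_sum]
  simp only [repr_coordSq, Complex.ofReal_re]

theorem exists_orthonormal_mem_convexHull (e : HilbertBasis ι ℂ H) (E : Submodule ℂ H)
    [FiniteDimensional ℂ E] {κ : Type*} [Fintype κ] (x : κ → E)
    (hx : ∑ i, ‖x i‖ ^ 2 = 1) :
    ∃ (n : ℕ) (u : Fin n → E), Orthonormal ℂ (fun j => (u j : H)) ∧
      ∑ i, coordSq e (x i : H) ∈ convexHull ℝ (Set.range fun j => coordSq e (u j : H)) := by
  obtain ⟨u, a, hu, ha, hsum, h⟩ := exists_orthonormal_diagonalization E x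
  refine ⟨_, u, hu.comp_linearIsometry E.subtypeₗᵢ, ?_⟩
  rw [sum_coordSq_eq_of_gram_eq e (fun i => (x i : H)) (fun j => (u j : H)) a h]
  exact (convex_convexHull ℝ _).sum_mem (fun j _ => ha j) (by rw [← hsum, hx])
    fun j _ => subset_convexHull ℝ _ ⟨j, rfl⟩

theorem exists_orthonormal_of_zero_mem_coordSqDiff (e : HilbertBasis ι ℂ H) (E F : Submodule ℂ H)
    [FiniteDimensional ℂ E] [FiniteDimensional ℂ F] (h0 : 0 ∈ coordSqDiff e E F) :
    ∃ (r s : ℕ) (v : Fin r → E) (w : Fin s → F),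
      Orthonormal ℂ (fun i => (v i : H)) ∧ Orthonormal ℂ (fun j => (w j : H)) ∧
      (convexHull ℝ (Set.range fun i => coordSq e (v i : H)) ∩
        convexHull ℝ (Set.range fun j => coordSq e (w j : H))).Nonempty := by
  obtain ⟨⟨X, Y⟩, hn, h⟩ := h0
  simp only [Set.mem_ofPred_eq, sub_eq_zero] at hn h
  have hX := hasSum_repr_sum_coordSq e fun i => (X i : H)
  rw [h] at hX
  have hXY : ∑ i, ‖X i‖ ^ 2 = ∑ j, ‖Y j‖ ^ 2 :=
    hX.unique (hasSum_repr_sum_coordSq e fun j => (Y j : H))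
  -- The two masses are equal and add up to one, so each is `1/2`; the factor `√2` normalizes both.
  have hscale : ∀ (G : Submodule ℂ H) (n : ℕ) (z : Fin n → G), ∑ i, ‖z i‖ ^ 2 = 1 / 2 →
      ∑ i, ‖((√2 : ℝ) : ℂ) • z i‖ ^ 2 = 1 ∧
      ∑ i, coordSq e (((((√2 : ℝ) : ℂ) • z i : G)) : H) = (2 : ℝ) • ∑ i, coordSq e (z i : H) := by
    intro G n z hz
    have h2 : √2 ^ 2 = (2 : ℝ) := Real.sq_sqrt (by norm_num)
    constructor
    · simp only [norm_smul, mul_pow, Complex.norm_real, Real.norm_eq_abs, sq_abs, h2,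
        ← Finset.mul_sum, hz]
      norm_num
    · simp only [Submodule.coe_smul, coordSq_ofReal_smul, h2, ← Finset.smul_sum]
  obtain ⟨hX1, hX2⟩ := hscale E _ X (by linarith)
  obtain ⟨hY1, hY2⟩ := hscale F _ Y (by linarith)
  obtain ⟨r, v, hv, hvm⟩ := exists_orthonormal_mem_convexHull e E _ hX1
  obtain ⟨s, w, hw, hwm⟩ := exists_orthonormal_mem_convexHull e F _ hY1
  refine ⟨r, s, v, w, hv, hw, _, hvm, ?_⟩
  rw [hX2, h, ← hY2]
  exact hwm

theorem exists_separating_diagonal [CompleteSpace H] (e : HilbertBasis ι ℂ H)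
    (E F : Submodule ℂ H) [FiniteDimensional ℂ E] [FiniteDimensional ℂ F]
    (h0 : 0 ∉ coordSqDiff e E F) :
    ∃ D ∈ diagonalCompactHermitian e,
      (∀ y ∈ E, ‖y‖ = 1 → (inner ℂ y (D y)).re < 0) ∧
      (∀ y ∈ F, ‖y‖ = 1 → 0 < (inner ℂ y (D y)).re) := by
  obtain ⟨f, c, hf, hc⟩ := RCLike.geometric_hahn_banach_closed_point (𝕜 := ℂ)
    (convex_coordSqDiff e E F) (isCompact_coordSqDiff e E F).isClosed h0
  have hneg : ∀ z ∈ coordSqDiff e E F, (f z).re < 0 := fun z hz => by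
    have h1 := hf z hz
    have h2 : c < 0 := by simpa using hc
    exact lt_trans h1 h2
  obtain ⟨d, hd, hdg⟩ := exists_real_vector_re_inner e ((InnerProductSpace.toDual ℂ H).symm f)
  have hform : ∀ y, (inner ℂ y (coordMulL e d y)).re = 2 * (f (coordSq e y)).re := fun y => by
    rw [inner_coordMulL_self e hd, hdg, InnerProductSpace.toDual_symm_apply]
  refine ⟨coordMulL e d, coordMulL_mem_diagonalCompactHermitian e hd, fun y hy hy1 => ?_,
    fun y hy hy1 => ?_⟩
  -- One unit vector on one side and the empty family on the other gives `±(y ∘ ȳ)` in the separated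
  -- set.
  · have h := hneg _ (mem_coordSqDiff_of_families e E F (fun _ : Unit => ⟨y, hy⟩)
      (fun i : Empty => i.elim) (by simp [hy1]))
    simp only [Finset.univ_unique, Finset.sum_singleton, Finset.univ_eq_empty, Finset.sum_empty,
      sub_zero] at h
    rw [hform]
    linarith
  · have h := hneg _ (mem_coordSqDiff_of_families e E F (fun i : Empty => i.elim)
      (fun _ : Unit => ⟨y, hy⟩) (by simp [hy1]))
    simp only [Finset.univ_unique, Finset.sum_singleton, Finset.univ_eq_empty, Finset.sum_empty,
      zero_sub, map_neg, Complex.neg_re] at h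
    rw [hform]
    linarith

/-- If `D` is diagonal and `re ⟪v, D v⟫ ≤ c` for all `v` in a family, then `∑ Dₖₖ pₖ ≤ c` for all
`p` in the convex hull of the vectors `v ∘ v̄`. -/
theorem exists_hasSum_le_of_mem_convexHull (e : HilbertBasis ι ℂ H) {D : H →L[ℂ] H}
    (hD : ∀ i j, i ≠ j → inner ℂ (D (e i)) (e j) = 0) {κ : Type*} (v : κ → H) {c : ℝ}
    (hc : ∀ i, (inner ℂ (v i) (D (v i))).re ≤ c) {p : H}
    (hp : p ∈ convexHull ℝ (Set.range fun i => coordSq e (v i))) :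
    ∃ t ≤ c, HasSum (fun k => (inner ℂ (e k) (D (e k))).re * (e.repr p k).re) t := by
  -- For general `p` the series may diverge, so summability is built into the convex set.
  let S : Set H :=
    {p | ∃ t ≤ c, HasSum (fun k => (inner ℂ (e k) (D (e k))).re * (e.repr p k).re) t}
  have hS : Convex ℝ S := by
    rintro x ⟨t, ht, hx⟩ y ⟨t', ht', hy⟩ a b ha hb hab
    refine ⟨a * t + b * t', ?_, ((hx.mul_left a).add (hy.mul_left b)).congr_fun fun k => ?_⟩
    · exact convex_Iic c ht ht' ha hb hab
    · rw [map_add, lp.coeFn_add, Pi.add_apply, repr_real_smul, repr_real_smul, Complex.add_re,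
        Complex.re_ofReal_mul, Complex.re_ofReal_mul]
      ring
  refine convexHull_min ?_ hS hp
  rintro _ ⟨i, rfl⟩
  exact ⟨_, hc i, hasSum_diagonal_re_inner e hD (v i)⟩

end Moments

end MinimalCompact

/-! ### The equivalence -/

open MinimalCompact in
theorem mainTheorem7 {ι H : Type*} [NormedAddCommGroup H] [InnerProductSpace ℂ H]
    [CompleteSpace H] [TopologicalSpace.SeparableSpace H] (e : HilbertBasis ι ℂ H)
    (C : H →L[ℂ] H) (hC : C ∈ MinimalCompact.compactHermitian) (hC0 : C ≠ 0)
    (hbal : MinimalCompact.lambdaMax C + MinimalCompact.lambdaMin C = 0) :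
    MinimalCompact.IsMinimal e C ↔
      ∃ (r s : ℕ) (v : Fin r → H) (w : Fin s → H),
        Orthonormal ℂ v ∧ Orthonormal ℂ w ∧
        (∀ i, v i ∈ Set.range (MinimalCompact.EPlus C)) ∧
        (∀ j, w j ∈ Set.range (MinimalCompact.EMinus C)) ∧
        (convexHull ℝ (Set.range fun i =>
            MinimalCompact.coordMul e (v i) (MinimalCompact.coordConj e (v i))) ∩
          convexHull ℝ (Set.range fun j =>
            MinimalCompact.coordMul e (w j) (MinimalCompact.coordConj e (w j)))).Nonempty := by
  obtain ⟨hmax, hmin⟩ := lambdaMax_eq_norm_and_lambdaMin_eq_neg_norm hC.1 hC0 hbal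
  have hn : ‖C‖ ≠ 0 := norm_ne_zero_iff.2 hC0
  simp only [EPlus, EMinus, hmax, hmin, mem_range_spectralProjection]
  constructor
  · intro hmini
    have : FiniteDimensional ℂ (C - ((‖C‖ : ℝ) : ℂ) • ContinuousLinearMap.id ℂ H).ker :=
      finiteDimensional_ker_sub_smul_id hC.2 hn
    have : FiniteDimensional ℂ (C - ((-‖C‖ : ℝ) : ℂ) • ContinuousLinearMap.id ℂ H).ker :=
      finiteDimensional_ker_sub_smul_id hC.2 (neg_ne_zero.2 hn)
    by_cases h0 : 0 ∈ coordSqDiff e (C - ((‖C‖ : ℝ) : ℂ) • ContinuousLinearMap.id ℂ H).ker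
        (C - ((-‖C‖ : ℝ) : ℂ) • ContinuousLinearMap.id ℂ H).ker
    · obtain ⟨r, s, v, w, hv, hw, h⟩ := exists_orthonormal_of_zero_mem_coordSqDiff e _ _ h0
      exact ⟨r, s, fun i => v i, fun j => w j, hv, hw, fun i => (v i).2, fun j => (w j).2, h⟩
    · exfalso
      obtain ⟨D, hD, hneg, hpos⟩ := exists_separating_diagonal e _ _ h0
      obtain ⟨t, ht⟩ := exists_norm_add_smul_lt hC.1 hC.2 hC0 hD.1.1 hD.1.2
        (fun y hy hCy => hneg y (mem_ker_sub_smul_id.2 hCy) hy)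
        (fun y hy hCy => hpos y (mem_ker_sub_smul_id.2 hCy) hy)
      refine (hmini ((t : ℂ) • D) ⟨⟨IsSelfAdjoint.smul ?_ hD.1.1, hD.1.2.smul _⟩,
        fun i j hij => ?_⟩).not_gt ht
      · simp [isSelfAdjoint_iff]
      · simp [hD.2 i j hij]
  · rintro ⟨r, s, v, w, hv, hw, hvE, hwE, p, hpv, hpw⟩ D hD
    simp only [mem_ker_sub_smul_id] at hvE hwE
    have hrayleigh : ∀ (x : H) (c : ℝ), ‖x‖ = 1 → C x = (c : ℂ) • x →
        (inner ℂ x (C x)).re = c := fun x c hx h => by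
      rw [h, inner_smul_right, inner_self_eq_norm_sq_to_K, hx]
      simp
    obtain ⟨t, ht, hts⟩ := exists_hasSum_le_of_mem_convexHull e hD.2 v (c := ‖C + D‖ - ‖C‖)
      (fun i => by
        have h := re_inner_apply_le (C + D) (hv.1 i)
        rw [add_apply, inner_add_right, Complex.add_re, hrayleigh _ _ (hv.1 i) (hvE i)] at h
        linarith) hpv
    obtain ⟨t', ht', hts'⟩ := exists_hasSum_le_of_mem_convexHull e (D := -D)
      (fun i j hij => by simp [hD.2 i j hij]) w (c := ‖C + D‖ - ‖C‖)
      (fun j => by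
        have h := re_inner_apply_le (-(C + D)) (hw.1 j)
        rw [norm_neg, neg_apply, add_apply, neg_add, inner_add_right, Complex.add_re,
          inner_neg_right, Complex.neg_re, hrayleigh _ _ (hw.1 j) (hwE j)] at h
        rw [neg_apply]
        linarith) hpw
    -- Both series are taken at the same `p`, hence `0 = t + t' ≤ 2(‖C + D‖ - ‖C‖)`.
    have : t' = -t := hts'.unique (hts.neg.congr_fun fun k => by simp)
    linarith
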